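/- Let $n\ge 0$ and let $\Omega\subseteq\mathbb{R}^n\setminus\{0\}$ be open, not necessarily bounded. Let $p\in\mathcal P(\Omega)$, that is: $p\in W^{1,1}_{loc}(\Omega)$ with weak gradient $\nabla p$, $1<\operatorname{ess\,inf}_\Omega p\le \operatorname{ess\,sup}_\Omega p<\infty$, and $p(x)^{p(x)},\ |\nabla p|^{p(x)}\in L^1_{loc}(\Omega)$. Let $\alpha>0$, $\beta>0$, $C_L\in\mathbb{R}$, and suppose that the function $L(x)=\langle\nabla p(x),x\rangle\log|x|$ is bounded from below by $C_L$ a.e. in $\Omega$, or is bounded from above by $C_L$ a.e. in $\Omega$. Let $\sigma:\Omega\to\mathbb{R}$ be measurable (for example, continuous) with $\sup_{x\in\Omega}\sigma(x)<\beta$ and $$\alpha\sigma(x)-n+\alpha-p(x)(\alpha-1)\ \ge\ (\alpha-1)C_L\qquad\text{for a.e. }x\in\Omega .$$ Put $$K_\alpha(x)=\sigma(x)-\frac1\alpha\Big[(\alpha-1)\big(\langle\nabla p(x),x\rangle\log|x|+p(x)\big)+n-\alpha\Big],$$ $$\mu_{1,\beta}(dx)=|x|^{\alpha(p(x)-\beta-1)-p(x)}\,\alpha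 K_\alpha(x)\,dx,\qquad \mu_{2,\beta}(dx)=|x|^{\alpha(p(x)-\beta-1)}\Big(\frac2\alpha\cdot\frac{p(x)-1}{\beta-\sigma(x)}\Big)^{p(x)-1}dx .$$ Then for every Lipschitz function $\xi:\Omega\to\mathbb{R}$ with compact support in $\Omega$, the three integrals below converge absolutely and $$\int_\Omega|\xi|^{p(x)}\mu_{1,\beta}(dx)\le\int_\Omega|\nabla\xi|^{p(x)}\mu_{2,\beta}(dx)+\int_\Omega\big|\xi\log|\xi|\big|^{p(x)}\,\frac{|\nabla p(x)|^{p(x)}}{p(x)^{p(x)}}\,\mu_{2,\beta}(dx),$$ where $0\log 0=0$. Moreover, if $\alpha\ge1$ and $L\le C_L$ a.e. in $\Omega$, or $0<\alpha<1$ and $L\ge C_L$ a.e. in $\Omega$, then $K_\alpha\ge0$ a.e. in $\Omega$, so that $\mu_{1,\beta}$ is a nonnegative measure. (If $K_\alpha$ changes sign, $\mu_{1,\beta}$ stands for its signed density.) -/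

import Mathlib

open MeasureTheory Set
open scoped ContDiff

noncomputable section

/-- `g` is the weak gradient of `f` on the open set `Ω`, and `f ∈ W^{1,1}_loc(Ω)`: both functions
are locally integrable on `Ω`, and integration by parts holds against every smooth test function
compactly supported in `Ω`, in every direction `v`. -/
structure IsWeakGradientOn {n : ℕ} (Ω : Set (EuclideanSpace ℝ (Fin n)))
    (f : EuclideanSpace ℝ (Fin n) → ℝ)
    (g : EuclideanSpace ℝ (Fin n) → EuclideanSpace ℝ (Fin n)) : Prop where
  locallyIntegrableOn : LocallyIntegrableOn f Ω volume
  locallyIntegrableOn_grad : LocallyIntegrableOn g Ω volume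
  integral_by_parts : ∀ φ : EuclideanSpace ℝ (Fin n) → ℝ, ContDiff ℝ ∞ φ →
    HasCompactSupport φ → tsupport φ ⊆ Ω → ∀ v : EuclideanSpace ℝ (Fin n),
      ∫ x in Ω, f x * fderiv ℝ φ x v = - ∫ x in Ω, φ x * inner ℝ (g x) v

/-- The exponent `p` belongs to the class `𝒫(Ω)`, with weak gradient `gradp`:
`p ∈ W^{1,1}_loc(Ω)`, `1 < ess inf p ≤ ess sup p < ∞` on `Ω`, and the functions `p^p` and
`|∇p|^p` are locally integrable on `Ω`. -/
structure IsExponentOn {n : ℕ} (Ω : Set (EuclideanSpace ℝ (Fin n)))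
    (p : EuclideanSpace ℝ (Fin n) → ℝ)
    (gradp : EuclideanSpace ℝ (Fin n) → EuclideanSpace ℝ (Fin n)) : Prop where
  weakGradient : IsWeakGradientOn Ω p gradp
  essBounds : ∃ a b : ℝ, 1 < a ∧ ∀ᵐ x ∂(volume.restrict Ω), a ≤ p x ∧ p x ≤ b
  locallyIntegrableOn_self_rpow : LocallyIntegrableOn (fun x => p x ^ p x) Ω volume
  locallyIntegrableOn_grad_rpow : LocallyIntegrableOn (fun x => ‖gradp x‖ ^ p x) Ω volume

/-- `⟨∇p(x), x⟩ log |x|`. -/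
def gradLogTerm {n : ℕ}
    (gradp : EuclideanSpace ℝ (Fin n) → EuclideanSpace ℝ (Fin n))
    (x : EuclideanSpace ℝ (Fin n)) : ℝ :=
  inner ℝ (gradp x) x * Real.log ‖x‖

/-- `K_α(x) = σ(x) - (1/α) [(α - 1) (⟨∇p(x), x⟩ log |x| + p(x)) + n - α]`. -/
def powerK {n : ℕ} (α : ℝ) (σ p : EuclideanSpace ℝ (Fin n) → ℝ)
    (gradp : EuclideanSpace ℝ (Fin n) → EuclideanSpace ℝ (Fin n))
    (x : EuclideanSpace ℝ (Fin n)) : ℝ :=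
  σ x - (1 / α) * ((α - 1) * (gradLogTerm gradp x + p x) + n - α)

/-- Density of `μ_{1,β}`: `|x|^{α(p(x) - β - 1) - p(x)} α K_α(x)`. -/
def powerWeight₁ {n : ℕ} (α β : ℝ) (σ p : EuclideanSpace ℝ (Fin n) → ℝ)
    (gradp : EuclideanSpace ℝ (Fin n) → EuclideanSpace ℝ (Fin n))
    (x : EuclideanSpace ℝ (Fin n)) : ℝ :=
  ‖x‖ ^ (α * (p x - β - 1) - p x) * (α * powerK α σ p gradp x)

/-- Density of `μ_{2,β}`: `|x|^{α(p(x) - β - 1)} ((2/α) (p(x) - 1)/(β - σ(x)))^{p(x) - 1}`. -/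
def powerWeight₂ {n : ℕ} (α β : ℝ) (σ p : EuclideanSpace ℝ (Fin n) → ℝ)
    (x : EuclideanSpace ℝ (Fin n)) : ℝ :=
  ‖x‖ ^ (α * (p x - β - 1)) * ((2 / α) * ((p x - 1) / (β - σ x))) ^ (p x - 1)

/-- The `p(x)`-Hardy inequality on `Ω` with weight densities `w₁` and `w₂`, where `gradp` is the
gradient of the exponent: for every Lipschitz function `ξ` compactly supported in `Ω` (extended
by zero), all three integrals converge and
`∫ |ξ|^p w₁ ≤ ∫ |∇ξ|^p w₂ + ∫ |ξ log |ξ||^p (|∇p|^p / p^p) w₂`.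
Here `gradient ξ` is the classical gradient, which exists almost everywhere. -/
def VariableHardyInequality {n : ℕ} (Ω : Set (EuclideanSpace ℝ (Fin n)))
    (p : EuclideanSpace ℝ (Fin n) → ℝ)
    (gradp : EuclideanSpace ℝ (Fin n) → EuclideanSpace ℝ (Fin n))
    (w₁ w₂ : EuclideanSpace ℝ (Fin n) → ℝ) : Prop :=
  ∀ ξ : EuclideanSpace ℝ (Fin n) → ℝ, (∃ C : NNReal, LipschitzOnWith C ξ Ω) →
    HasCompactSupport ξ → tsupport ξ ⊆ Ω →
    IntegrableOn (fun x => |ξ x| ^ p x * w₁ x) Ω volume ∧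
    IntegrableOn (fun x => ‖gradient ξ x‖ ^ p x * w₂ x) Ω volume ∧
    IntegrableOn (fun x => |ξ x * Real.log (|ξ x|)| ^ p x *
      (‖gradp x‖ ^ p x / p x ^ p x) * w₂ x) Ω volume ∧
    ∫ x in Ω, |ξ x| ^ p x * w₁ x ≤
      (∫ x in Ω, ‖gradient ξ x‖ ^ p x * w₂ x) +
      ∫ x in Ω, |ξ x * Real.log (|ξ x|)| ^ p x *
        (‖gradp x‖ ^ p x / p x ^ p x) * w₂ x

end

/-! Write `X = |x|`, `A = α - 1`, `B = -α(β + 1)`, so that `A p + B = α(p - β - 1) - p`. The field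
`X^(A p + B) |ξ|^p x` is compactly supported away from the origin, so its divergence integrates to
zero (`IsWeakGradientOn.integral_div_rpow_eq_zero`). Adding this zero to the left side cancels the
terms in `n`, `p` and `⟨∇p, x⟩ log X` of `K_α`. What remains is `X^(A p + B) |ξ|^p` times `-α(β - σ)
+ p ⟨∇ξ, x⟩ / ξ + ⟨∇p, x⟩ log |ξ|`. Young's inequality on each of the last two terms costs `α(β -
σ)/2`, so the negative term pays for both and the right side is left (`powerWeight_pointwise_le`).

The analytic work is the divergence identity, as `p` is only weakly differentiable and `|ξ|^p` is
singular at zeros of `ξ`. The exponent is mollified and `|ξ|^q` replaced by `(ξ² + η²)^(q/2) - η^q`;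
the approximants are Lipschitz, and the classical divergence theorem applies. The gradients of the
mollified exponents have no common dominating function, only dominating functions that converge a.e.
and in mean, which suffices for the limit. -/

section Auxiliary

open Filter Topology
open scoped Convolution

/-! ### Convergence of integrals, Lipschitz functions and the divergence theorem. -/

/-- Dominated convergence with varying dominating functions. -/
theorem tendsto_integral_of_varying_dominated {X : Type*} [MeasurableSpace X] {μ : Measure X}
    {F G : ℕ → X → ℝ} {f g : X → ℝ}
    (hF : ∀ k, AEStronglyMeasurable (F k) μ) (hG : ∀ k, Integrable (G k) μ) (hg : Integrable g μ)
    (hFG : ∀ k, ∀ᵐ x ∂μ, |F k x| ≤ G k x)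
    (hFf : ∀ᵐ x ∂μ, Tendsto (fun k => F k x) atTop (𝓝 (f x)))
    (hGg : ∀ᵐ x ∂μ, Tendsto (fun k => G k x) atTop (𝓝 (g x)))
    (hint : Tendsto (fun k => ∫ x, G k x ∂μ) atTop (𝓝 (∫ x, g x ∂μ))) :
    Integrable f μ ∧ Tendsto (fun k => ∫ x, F k x ∂μ) atTop (𝓝 (∫ x, f x ∂μ)) := by
  have hFG' : ∀ᵐ x ∂μ, ∀ k, |F k x| ≤ G k x := ae_all_iff.2 hFG
  have hfg : ∀ᵐ x ∂μ, |f x| ≤ g x := by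
    filter_upwards [hFG', hFf, hGg] with x h1 h2 h3
    exact le_of_tendsto_of_tendsto' h2.abs h3 h1
  have hFi : ∀ k, Integrable (F k) μ := fun k => (hG k).mono' (hF k) (hFG k)
  have hmin : Tendsto (fun k => ∫ x, min (G k x) (g x) ∂μ) atTop (𝓝 (∫ x, g x ∂μ)) := by
    refine tendsto_integral_of_dominated_convergence g
      (fun k => ((hG k).inf hg).aestronglyMeasurable) hg ?_ ?_
    · intro k
      filter_upwards [hFG', hfg] with x h1 h2
      have h3 := (abs_nonneg _).trans (h1 k)
      have h4 := (abs_nonneg _).trans h2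
      rw [Real.norm_of_nonneg (le_min h3 h4)]
      exact min_le_right _ _
    · filter_upwards [hGg] with x h
      simpa using h.min (tendsto_const_nhds (x := g x))
  -- Clamping `F k` to `[-g, g]` gives a sequence with the fixed majorant `g`. The clamping error is
  -- at most `G k - min (G k) g`, whose integral tends to zero.
  have hT : Tendsto (fun k => ∫ x, max (-(g x)) (min (F k x) (g x)) ∂μ) atTop
      (𝓝 (∫ x, f x ∂μ)) := by
    refine tendsto_integral_of_dominated_convergence g
      (fun k => (hg.neg.sup ((hFi k).inf hg)).aestronglyMeasurable) hg ?_ ?_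
    · intro k
      filter_upwards [hfg] with x h2
      have h4 := (abs_nonneg _).trans h2
      rw [Real.norm_eq_abs, abs_le]
      exact ⟨le_max_left _ _, max_le (by linarith) (min_le_right _ _)⟩
    · filter_upwards [hFf, hfg] with x h h2
      have := (tendsto_const_nhds (x := -(g x)) (f := (atTop : Filter ℕ))).max
        (h.min (tendsto_const_nhds (x := g x)))
      rwa [min_eq_left (abs_le.1 h2).2, max_eq_right (abs_le.1 h2).1] at this
  have hdiff : Tendsto (fun k => (∫ x, F k x ∂μ) - ∫ x, max (-(g x)) (min (F k x) (g x)) ∂μ)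
      atTop (𝓝 0) := by
    have hz : Tendsto (fun k => (∫ x, G k x ∂μ) - ∫ x, min (G k x) (g x) ∂μ) atTop (𝓝 0) := by
      simpa using hint.sub hmin
    refine squeeze_zero_norm (fun k => ?_) hz
    have hTi : Integrable (fun x => max (-(g x)) (min (F k x) (g x))) μ :=
      hg.neg.sup ((hFi k).inf hg)
    have hMi : Integrable (fun x => min (G k x) (g x)) μ := (hG k).inf hg
    rw [← integral_sub (hFi k) hTi, ← integral_sub (hG k) hMi]
    refine norm_integral_le_of_norm_le ((hG k).sub hMi) ?_
    filter_upwards [hFG', hfg] with x h1 h2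
    have h3 := abs_le.1 (h1 k)
    have h4 := (abs_nonneg _).trans h2
    rw [Real.norm_eq_abs, abs_le]
    rcases max_cases (-(g x)) (min (F k x) (g x)) with h | h <;>
    rcases min_cases (F k x) (g x) with h' | h' <;>
    rcases min_cases (G k x) (g x) with h'' | h'' <;>
    constructor <;> linarith
  exact ⟨hg.mono' (aestronglyMeasurable_of_tendsto_ae atTop hF hFf) hfg, by simpa using hdiff.add hT⟩

/-- A compactly supported function that is Lipschitz near each point of its support is
Lipschitz. -/
theorem HasCompactSupport.exists_lipschitzWith {E : Type*} [NormedAddCommGroup E]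
    [NormedSpace ℝ E] [FiniteDimensional ℝ E] {f : E → ℝ} (hf : HasCompactSupport f)
    (h : ∀ x ∈ tsupport f, ∃ K : NNReal, ∃ t ∈ 𝓝 x, LipschitzOnWith K f t) :
    ∃ K : NNReal, LipschitzWith K f := by
  have hloc : LocallyLipschitz f := by
    intro x
    by_cases hx : x ∈ tsupport f
    · exact h x hx
    · refine ⟨0, (tsupport f)ᶜ, (isClosed_tsupport f).isOpen_compl.mem_nhds hx, ?_⟩
      intro y hy z hz
      rw [image_eq_zero_of_notMem_tsupport hy, image_eq_zero_of_notMem_tsupport hz]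
      simp
  have : ProperSpace E := FiniteDimensional.proper_real E
  obtain ⟨R, hR⟩ := hf.isCompact.isBounded.subset_closedBall (0 : E)
  -- The gap of width one matters: from a point of the `R`-ball to one outside the `R + 1`-ball the
  -- distance is at least `1`, so the sup bound `M` serves as a Lipschitz constant.
  obtain ⟨K, hK⟩ := (hloc.locallyLipschitzOn (s := Metric.closedBall (0 : E) (R + 1))
    ).exists_lipschitzOnWith_of_compact (isCompact_closedBall _ _)
  obtain ⟨M, hM⟩ := hf.exists_bound_of_continuous hloc.continuous
  have hM0 : 0 ≤ M := (norm_nonneg _).trans (hM 0)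
  have hout : ∀ x ∉ Metric.closedBall (0 : E) R, f x = 0 := fun x hx =>
    image_eq_zero_of_notMem_tsupport fun hx' => hx (hR hx')
  have key : ∀ x ∈ Metric.closedBall (0 : E) (R + 1), ∀ y ∉ Metric.closedBall (0 : E) (R + 1),
      dist (f x) (f y) ≤ max (K : ℝ) M * dist x y := by
    intro x hx y hy
    have hy0 : f y = 0 := hout y fun hy' => hy (Metric.closedBall_subset_closedBall (by linarith) hy')
    by_cases hx' : x ∈ Metric.closedBall (0 : E) R
    · have h1 : 1 ≤ dist x y := by
        simp only [Metric.mem_closedBall, dist_zero_right, not_le] at hx' hy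
        have := norm_sub_norm_le y x
        rw [dist_comm, dist_eq_norm]; linarith
      rw [hy0, dist_zero_right]
      calc ‖f x‖ ≤ M := hM x
        _ ≤ max (K : ℝ) M * 1 := by rw [mul_one]; exact le_max_right _ _
        _ ≤ _ := by gcongr
    · rw [hout x hx', hy0, dist_self]; positivity
  refine ⟨max K M.toNNReal, LipschitzWith.of_dist_le_mul fun x y => ?_⟩
  rw [NNReal.coe_max, Real.coe_toNNReal _ hM0]
  by_cases hx : x ∈ Metric.closedBall (0 : E) (R + 1) <;>
    by_cases hy : y ∈ Metric.closedBall (0 : E) (R + 1)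
  · refine (hK.dist_le_mul x hx y hy).trans ?_
    gcongr; exact le_max_left _ _
  · exact key x hx y hy
  · rw [dist_comm, dist_comm x]; exact key y hy x hx
  · rw [hout x fun h => hx (Metric.closedBall_subset_closedBall (by linarith) h),
      hout y fun h => hy (Metric.closedBall_subset_closedBall (by linarith) h), dist_self]
    positivity

/-- The divergence theorem for the vector field `x ↦ f x • x` with `f` Lipschitz and compactly
supported. -/
theorem integral_add_fderiv_self_eq_zero {n : ℕ} {f : EuclideanSpace ℝ (Fin n) → ℝ}
    {C : NNReal} (hf : LipschitzWith C f) (hc : HasCompactSupport f) :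
    ∫ x, ((n : ℝ) * f x + fderiv ℝ f x x) = 0 := by
  have hfi : Integrable f volume := hf.continuous.integrable_of_hasCompactSupport hc
  have hdi : ∀ i : Fin n, Integrable
      (fun x => fderiv ℝ f x (EuclideanSpace.single i 1) * x i) volume := by
    intro i
    obtain ⟨R, hR⟩ := hc.isCompact.isBounded.subset_closedBall (0 : EuclideanSpace ℝ (Fin n))
    have hz : ∀ x ∉ tsupport f, fderiv ℝ f x (EuclideanSpace.single i 1) * x i = 0 := by
      intro x hx
      have : fderiv ℝ f x = 0 := by
        by_contra h
        exact hx (support_fderiv_subset ℝ h)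
      simp [this]
    refine (integrableOn_iff_integrable_of_support_subset (s := tsupport f) ?_).1 ?_
    · intro x hx; by_contra h; exact hx (hz x h)
    refine IntegrableOn.of_bound hc.isCompact.measure_lt_top ?_ (C * R) ?_
    · exact ((measurable_fderiv_apply_const ℝ f _).mul (by fun_prop)).aestronglyMeasurable
    · refine (ae_restrict_iff' hc.isCompact.isClosed.measurableSet).2 (ae_of_all _ fun x hx => ?_)
      have h1 : ‖x‖ ≤ R := by simpa using hR hx
      rw [norm_mul]
      gcongr
      · refine ((fderiv ℝ f x).le_opNorm _).trans ?_
        simpa using norm_fderiv_le_of_lipschitz ℝ hf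
      · exact (PiLp.norm_apply_le x i).trans h1
  have hi : ∀ i : Fin n,
      ∫ x, fderiv ℝ f x (EuclideanSpace.single i 1) * x i = - ∫ x, f x := by
    intro i
    have hlip : LipschitzWith ‖(EuclideanSpace.proj i : EuclideanSpace ℝ (Fin n) →L[ℝ] ℝ)‖₊
      (fun x : EuclideanSpace ℝ (Fin n) => x i) :=
      (EuclideanSpace.proj i : EuclideanSpace ℝ (Fin n) →L[ℝ] ℝ).lipschitz
    -- Integration by parts against the coordinate function; compact support is needed of `f` only.
    have h := LipschitzWith.integral_lineDeriv_mul_eq (μ := volume) hlip hf hc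
      (EuclideanSpace.single i 1)
    have h1 : ∀ x : EuclideanSpace ℝ (Fin n), lineDeriv ℝ (fun x : EuclideanSpace ℝ (Fin n) => x i)
        x (EuclideanSpace.single i 1) = 1 := by
      intro x
      have := ((EuclideanSpace.proj i : EuclideanSpace ℝ (Fin n) →L[ℝ] ℝ).hasFDerivAt
        (x := x)).hasLineDerivAt (EuclideanSpace.single i 1)
      simpa using this.lineDeriv
    simp only [h1, one_mul] at h
    rw [h, ← integral_neg]
    refine integral_congr_ae ?_
    filter_upwards [hf.ae_differentiableAt] with x hx
    rw [hx.lineDeriv_eq_fderiv]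
    simp
  have hsum : ∀ x : EuclideanSpace ℝ (Fin n),
      fderiv ℝ f x x = ∑ i, fderiv ℝ f x (EuclideanSpace.single i 1) * x i := by
    intro x
    have h := congrArg (fderiv ℝ f x) ((EuclideanSpace.basisFun (Fin n) ℝ).sum_repr x)
    rw [← h, map_sum]
    simp [mul_comm]
  simp_rw [hsum]
  rw [integral_add (hfi.const_mul _) (integrable_finsetSum _ fun i _ => hdi i),
    integral_finsetSum _ fun i _ => hdi i, integral_const_mul]
  simp [hi]

/-! ### Mollification of the exponent. -/

/-- Differentiation under a convolution with a smooth compactly supported kernel. -/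
theorem fderiv_convolution_lsmul_apply {n : ℕ} {ψ P : EuclideanSpace ℝ (Fin n) → ℝ}
    (hψ : ContDiff ℝ ∞ ψ) (hc : HasCompactSupport ψ) (hP : LocallyIntegrable P volume)
    (x v : EuclideanSpace ℝ (Fin n)) :
    fderiv ℝ (ψ ⋆[ContinuousLinearMap.lsmul ℝ ℝ, volume] P) x v =
      ∫ y, P y * fderiv ℝ ψ (x - y) v := by
  have h1 := hc.hasFDerivAt_convolution_left (ContinuousLinearMap.lsmul ℝ ℝ (E := ℝ))
    (hψ.of_le (by simp)) hP x
  have hex : Integrable (fun y => (ContinuousLinearMap.lsmul ℝ ℝ (E := ℝ)).precompL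
      (EuclideanSpace ℝ (Fin n)) (fderiv ℝ ψ (x - y)) (P y)) volume :=
    ((hc.fderiv (𝕜 := ℝ)).convolutionExists_left _
      (hψ.continuous_fderiv (by simp)) hP x).integrable_swap
  rw [h1.fderiv, convolution_eq_swap, ContinuousLinearMap.integral_apply hex]
  refine integral_congr_ae (ae_of_all _ fun y => ?_)
  simp [mul_comm]

/-- A weakly differentiable function is approximated near a compact set by smooth functions with
the same bounds, whose gradients converge almost everywhere and are dominated by a sequence that
converges in mean. -/
theorem IsWeakGradientOn.exists_smooth_approx {n : ℕ} {Ω : Set (EuclideanSpace ℝ (Fin n))}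
    (hΩ : IsOpen Ω) {p : EuclideanSpace ℝ (Fin n) → ℝ}
    {g : EuclideanSpace ℝ (Fin n) → EuclideanSpace ℝ (Fin n)} (hpg : IsWeakGradientOn Ω p g)
    {a b : ℝ} (hab : ∀ᵐ x ∂(volume.restrict Ω), a ≤ p x ∧ p x ≤ b)
    {S : Set (EuclideanSpace ℝ (Fin n))} (hS : IsCompact S) (hSΩ : S ⊆ Ω) :
    ∃ (q h : ℕ → EuclideanSpace ℝ (Fin n) → ℝ) (h' : EuclideanSpace ℝ (Fin n) → ℝ),
      (∀ k, ContDiff ℝ ∞ (q k)) ∧ (∀ k, ∀ x ∈ S, a ≤ q k x ∧ q k x ≤ b) ∧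
      (∀ k, ∀ x ∈ S, ‖fderiv ℝ (q k) x‖ ≤ h k x) ∧ (∀ k x, 0 ≤ h k x) ∧
      (∀ k, Integrable (h k) volume) ∧ Integrable h' volume ∧
      (∀ᵐ x, Tendsto (fun k => h k x) atTop (𝓝 (h' x))) ∧
      Tendsto (fun k => ∫ x, h k x) atTop (𝓝 (∫ x, h' x)) ∧
      (∀ᵐ x, x ∈ S → Tendsto (fun k => q k x) atTop (𝓝 (p x))) ∧
      (∀ᵐ x, x ∈ S → ∀ v, Tendsto (fun k => fderiv ℝ (q k) x v) atTop (𝓝 (inner ℝ (g x) v))) := by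
  obtain ⟨δ, hδ, hδΩ⟩ := hS.exists_cthickening_subset_open hΩ hSΩ
  set T := Metric.cthickening δ S with hTdef
  have hT : IsCompact T := hS.cthickening
  have hTm : MeasurableSet T := hT.measurableSet
  have hST : S ⊆ T := Metric.self_subset_cthickening S
  -- Outer radii below `δ` keep kernels centred in `S` inside `T`; the fixed ratio of the radii is
  -- what a.e. convergence at Lebesgue points requires.
  let φ : ℕ → ContDiffBump (0 : EuclideanSpace ℝ (Fin n)) := fun k =>
    ⟨δ / (k + 2) / 2, δ / (k + 2), by positivity, half_lt_self (by positivity)⟩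
  have hφout : ∀ k, (φ k).rOut = δ / (k + 2) := fun k => rfl
  have hφlt : ∀ k, (φ k).rOut ≤ δ := fun k => by
    rw [hφout]; apply div_le_self hδ.le; have : (0 : ℝ) ≤ k := k.cast_nonneg
    linarith
  have hφ0 : Tendsto (fun k => (φ k).rOut) atTop (𝓝 0) := by
    simp only [hφout]
    exact Tendsto.div_atTop tendsto_const_nhds
      (tendsto_atTop_add_const_right _ _ tendsto_natCast_atTop_atTop)
  have hφK : ∀ᶠ k in atTop, (φ k).rOut ≤ 2 * (φ k).rIn := by
    refine Eventually.of_forall fun k => le_of_eq ?_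
    change δ / (k + 2) = 2 * (δ / (k + 2) / 2); ring
  set ψ : ℕ → EuclideanSpace ℝ (Fin n) → ℝ := fun k => (φ k).normed volume with hψ
  have hψs : ∀ k, ContDiff ℝ ∞ (ψ k) := fun k => (φ k).contDiff_normed
  have hψc : ∀ k, HasCompactSupport (ψ k) := fun k => (φ k).hasCompactSupport_normed
  have hψ0 : ∀ k x, 0 ≤ ψ k x := fun k x => (φ k).nonneg_normed x
  have hψi : ∀ k, Integrable (ψ k) volume := fun k => (φ k).integrable_normed
  have hψ1 : ∀ k, ∫ x, ψ k x = 1 := fun k => (φ k).integral_normed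
  have hψT : ∀ k, ∀ x ∈ S, tsupport (fun y => ψ k (x - y)) ⊆ T := by
    intro k x hx
    have h1 : tsupport (fun y => ψ k (x - y)) ⊆ Metric.closedBall x δ := by
      refine closure_minimal (fun y hy => ?_) Metric.isClosed_closedBall
      have : x - y ∈ Function.support (ψ k) := hy
      rw [(φ k).support_normed_eq] at this
      rw [Metric.mem_closedBall, dist_comm, dist_eq_norm]
      rw [Metric.mem_ball, dist_zero_right] at this
      exact this.le.trans (hφlt k)
    exact h1.trans (Metric.closedBall_subset_cthickening hx δ)
  have hψz : ∀ k, ∀ x ∈ S, ∀ y ∉ T, ψ k (x - y) = 0 := fun k x hx y hy =>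
    image_eq_zero_of_notMem_tsupport (f := fun y => ψ k (x - y)) fun h => hy (hψT k x hx h)
  set P := T.indicator p with hP
  set G := T.indicator g with hG
  have hPi : Integrable P volume :=
    (integrable_indicator_iff hTm).2 (hpg.locallyIntegrableOn.integrableOn_compact_subset hδΩ hT)
  have hGi : Integrable G volume := (integrable_indicator_iff hTm).2
    (hpg.locallyIntegrableOn_grad.integrableOn_compact_subset hδΩ hT)
  let L := ContinuousLinearMap.lsmul ℝ ℝ (E := ℝ)
  let L' := ContinuousLinearMap.lsmul ℝ ℝ (E := EuclideanSpace ℝ (Fin n))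
  have hex : ∀ k x, Integrable (fun y => ψ k (x - y) * P y) volume := fun k x =>
    ((hψc k).convolutionExists_left L (hψs k).continuous hPi.locallyIntegrable x).integrable_swap
  have hexG : ∀ k x, Integrable (fun y => ψ k (x - y) • G y) volume := fun k x =>
    ((hψc k).convolutionExists_left L' (hψs k).continuous hGi.locallyIntegrable x).integrable_swap
  have hq : ∀ k x, (ψ k ⋆[L, volume] P) x = ∫ y, ψ k (x - y) * P y := fun k x => by
    rw [convolution_eq_swap]; rfl
  -- For `x ∈ S` the function `y ↦ ψ k (x - y)` is an admissible test function. Differentiating in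
  -- `y` instead of `x` flips the sign, which absorbs the minus of the integration by parts.
  have hderiv : ∀ k, ∀ x ∈ S, ∀ v, fderiv ℝ (ψ k ⋆[L, volume] P) x v =
      inner ℝ ((ψ k ⋆[L', volume] G) x) v := by
    intro k x hx v
    have h2 := fderiv_convolution_lsmul_apply (hψs k) (hψc k) hPi.locallyIntegrable x v
    have hχs : ContDiff ℝ ∞ (fun y => ψ k (x - y)) := (hψs k).comp (contDiff_const.sub contDiff_id)
    have hχc : HasCompactSupport (fun y => ψ k (x - y)) :=
      HasCompactSupport.of_support_subset_isCompact hT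
        ((subset_tsupport _).trans (hψT k x hx))
    have hχd : ∀ y, fderiv ℝ (fun y => ψ k (x - y)) y v = - fderiv ℝ (ψ k) (x - y) v := by
      intro y
      have := (((hψs k).differentiable (by simp)) (x - y)).hasFDerivAt.comp y
        ((hasFDerivAt_id y).const_sub x)
      have h' := this.fderiv
      simp only [Function.comp_def] at h'
      rw [h']; simp
    have h3 := hpg.integral_by_parts _ hχs hχc ((hψT k x hx).trans hδΩ) v
    have h4 : ∫ y in Ω, p y * fderiv ℝ (fun y => ψ k (x - y)) y v =
        - ∫ y, P y * fderiv ℝ (ψ k) (x - y) v := by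
      have : (fun y => P y * fderiv ℝ (ψ k) (x - y) v) =
          T.indicator (fun y => p y * fderiv ℝ (ψ k) (x - y) v) := by
        ext y; by_cases hy : y ∈ T <;> simp [P, hy]
      rw [this, integral_indicator hTm, ← integral_neg]
      rw [setIntegral_eq_of_subset_of_forall_sdiff_eq_zero hΩ.measurableSet hδΩ]
      · simp [hχd]
      · intro y hy
        have : fderiv ℝ (fun y => ψ k (x - y)) y = 0 := by
          by_contra h
          exact hy.2 (hψT k x hx (support_fderiv_subset ℝ h))
        simp [this]
    have h5 : ∫ y in Ω, ψ k (x - y) * inner ℝ (g y) v = inner ℝ ((ψ k ⋆[L', volume] G) x) v := by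
      have e1 : (ψ k ⋆[L', volume] G) x = ∫ y, ψ k (x - y) • G y := by
        rw [convolution_eq_swap]; rfl
      rw [e1, real_inner_comm, ← integral_inner (hexG k x)]
      have : (fun y => inner ℝ v (ψ k (x - y) • G y)) =
          T.indicator (fun y => ψ k (x - y) * inner ℝ (g y) v) := by
        ext y; by_cases hy : y ∈ T <;> simp [G, hy, inner_smul_right, real_inner_comm]
      rw [this, integral_indicator hTm]
      rw [setIntegral_eq_of_subset_of_forall_sdiff_eq_zero hΩ.measurableSet hδΩ]
      intro y hy
      simp [hψz k x hx y hy.2]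
    rw [h2, ← h5]
    linarith
  have hnorm : ∀ k x, ‖(ψ k ⋆[L', volume] G) x‖ ≤ (ψ k ⋆[L, volume] fun y => ‖G y‖) x := by
    intro k x
    rw [convolution_eq_swap, convolution_eq_swap]
    refine (norm_integral_le_integral_norm _).trans (le_of_eq ?_)
    refine integral_congr_ae (ae_of_all _ fun y => ?_)
    simp [L, L', norm_smul, abs_of_nonneg (hψ0 k (x - y))]
  have hlim : ∀ᵐ x, Tendsto (fun k => (ψ k ⋆[L', volume] G) x) atTop (𝓝 (G x)) :=
    ContDiffBump.ae_convolution_tendsto_right_of_locallyIntegrable hφ0 hφK hGi.locallyIntegrable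
  refine ⟨fun k => ψ k ⋆[L, volume] P, fun k => ψ k ⋆[L, volume] fun y => ‖G y‖,
    fun y => ‖G y‖, ?_, ?_, ?_, ?_, ?_, hGi.norm, ?_, ?_, ?_, ?_⟩
  · exact fun k => (hψc k).contDiff_convolution_left L (hψs k) hPi.locallyIntegrable
  · intro k x hx
    have hc : ∀ c : ℝ, Integrable (fun y => ψ k (x - y) * c) volume := fun c =>
      ((hψi k).comp_sub_left x).mul_const c
    have hcv : ∀ c : ℝ, ∫ y, ψ k (x - y) * c = c := fun c => by
      rw [integral_mul_const, integral_sub_left_eq_self (ψ k) volume x, hψ1, one_mul]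
    -- Off `T` the value `P y = 0` may violate the bounds, but the kernel vanishes there.
    have hab' : ∀ᵐ y, ψ k (x - y) * a ≤ ψ k (x - y) * P y ∧
        ψ k (x - y) * P y ≤ ψ k (x - y) * b := by
      filter_upwards [(ae_restrict_iff' hΩ.measurableSet).1 hab] with y hy
      by_cases hyT : y ∈ T
      · have := hy (hδΩ hyT)
        simp only [P, indicator_of_mem hyT]
        exact ⟨mul_le_mul_of_nonneg_left this.1 (hψ0 _ _),
          mul_le_mul_of_nonneg_left this.2 (hψ0 _ _)⟩
      · simp [hψz k x hx y hyT]
    simp only [hq]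
    constructor
    · rw [← hcv a]
      exact integral_mono_ae (hc a) (hex k x) (hab'.mono fun y h => h.1)
    · rw [← hcv b]
      exact integral_mono_ae (hex k x) (hc b) (hab'.mono fun y h => h.2)
  · intro k x hx
    refine ContinuousLinearMap.opNorm_le_bound _ ((norm_nonneg _).trans (hnorm k x)) fun v => ?_
    rw [hderiv k x hx v]
    exact (norm_inner_le_norm _ _).trans (by gcongr; exact hnorm k x)
  · exact fun k x => (norm_nonneg _).trans (hnorm k x)
  · exact fun k => (hψi k).integrable_convolution L hGi.norm
  · exact ContDiffBump.ae_convolution_tendsto_right_of_locallyIntegrable hφ0 hφK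
      hGi.norm.locallyIntegrable
  -- Kernels of mass one preserve the integral, so the sequence of integrals is constant.
  · have : ∀ k, ∫ x, (ψ k ⋆[L, volume] fun y => ‖G y‖) x = ∫ y, ‖G y‖ := fun k => by
      rw [integral_convolution L (hψi k) hGi.norm, hψ1]; simp [L]
    simp only [this]
    exact tendsto_const_nhds
  · filter_upwards [ContDiffBump.ae_convolution_tendsto_right_of_locallyIntegrable hφ0 hφK
      hPi.locallyIntegrable] with x hx hxS
    simpa only [P, indicator_of_mem (hST hxS)] using hx
  · filter_upwards [hlim] with x hx hxS v
    simp only [hderiv _ x hxS]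
    simp only [G, indicator_of_mem (hST hxS)] at hx
    exact hx.inner tendsto_const_nhds

/-! ### The regularised power: regularity, derivative, limit and bounds. -/

/-- The regularisation `‖x‖ ^ (A q + B) ((ξ² + η²) ^ (q / 2) - η ^ q)` of
`‖x‖ ^ (A q + B) |ξ| ^ q`. -/
noncomputable def regularizedPower {n : ℕ} (A B η : ℝ) (q ξ : EuclideanSpace ℝ (Fin n) → ℝ)
    (x : EuclideanSpace ℝ (Fin n)) : ℝ :=
  Real.exp ((A * q x + B) * Real.log ‖x‖) *
    (Real.exp (q x * (Real.log (ξ x ^ 2 + η ^ 2) / 2)) - Real.exp (q x * Real.log η))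

theorem regularizedPower_eq_zero {n : ℕ} (A B : ℝ) {η : ℝ}
    (q : EuclideanSpace ℝ (Fin n) → ℝ) {ξ : EuclideanSpace ℝ (Fin n) → ℝ}
    {x : EuclideanSpace ℝ (Fin n)} (hx : ξ x = 0) : regularizedPower A B η q ξ x = 0 := by
  simp [regularizedPower, hx, Real.log_pow]

theorem tsupport_regularizedPower_subset {n : ℕ} (A B η : ℝ)
    (q ξ : EuclideanSpace ℝ (Fin n) → ℝ) :
    tsupport (regularizedPower A B η q ξ) ⊆ tsupport ξ := by
  refine closure_mono fun x hx => ?_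
  by_contra h
  exact hx (regularizedPower_eq_zero A B q (by simpa using h))

/-- Near a point `x ≠ 0` this is a `C¹` function of the pair `(x, ξ x)`, because `η > 0` keeps the
second logarithm away from its singularity. -/
theorem exists_lipschitzWith_regularizedPower {n : ℕ} (A B : ℝ) {η : ℝ} (hη : 0 < η)
    {q ξ : EuclideanSpace ℝ (Fin n) → ℝ} (hq : ContDiff ℝ ∞ q) {C : NNReal}
    (hξ : LipschitzWith C ξ) (hc : HasCompactSupport ξ)
    (h0 : (0 : EuclideanSpace ℝ (Fin n)) ∉ tsupport ξ) :
    ∃ K : NNReal, LipschitzWith K (regularizedPower A B η q ξ) := by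
  refine HasCompactSupport.exists_lipschitzWith (hc.mono' (subset_closure.trans
    (tsupport_regularizedPower_subset A B η q ξ))) fun x hx => ?_
  have hx0 : x ≠ 0 := fun h => h0 (h ▸ tsupport_regularizedPower_subset A B η q ξ hx)
  let Φ : EuclideanSpace ℝ (Fin n) × ℝ → ℝ := fun z =>
    Real.exp ((A * q z.1 + B) * Real.log ‖z.1‖) *
      (Real.exp (q z.1 * (Real.log (z.2 ^ 2 + η ^ 2) / 2)) - Real.exp (q z.1 * Real.log η))
  have hq1 : ContDiffAt ℝ 1 (fun z : EuclideanSpace ℝ (Fin n) × ℝ => q z.1) (x, ξ x) :=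
    ((hq.of_le (by simp)).comp contDiff_fst).contDiffAt
  have hlog : ContDiffAt ℝ 1 (fun z : EuclideanSpace ℝ (Fin n) × ℝ => Real.log ‖z.1‖)
      (x, ξ x) := by
    have h1 : ContDiffAt ℝ 1 (fun z : EuclideanSpace ℝ (Fin n) × ℝ => ‖z.1‖) (x, ξ x) :=
      contDiffAt_fst.norm ℝ hx0
    exact h1.log (by simpa using hx0)
  have hlog2 : ContDiffAt ℝ 1 (fun z : EuclideanSpace ℝ (Fin n) × ℝ =>
      Real.log (z.2 ^ 2 + η ^ 2)) (x, ξ x) :=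
    ((contDiffAt_snd.pow 2).add contDiffAt_const).log (by positivity)
  have hΦ : ContDiffAt ℝ 1 Φ (x, ξ x) :=
    (((contDiffAt_const.mul hq1).add contDiffAt_const).mul hlog).exp.mul
      ((hq1.mul (hlog2.div_const 2)).exp.sub (hq1.mul contDiffAt_const).exp)
  obtain ⟨K, t, ht, hK⟩ := hΦ.exists_lipschitzOnWith
  have hpair : LipschitzWith (max 1 C) (fun y => (y, ξ y)) := LipschitzWith.id.prodMk hξ
  refine ⟨K * max 1 C, (fun y => (y, ξ y)) ⁻¹' t, hpair.continuous.continuousAt ht, ?_⟩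
  exact hK.comp (hpair.lipschitzOnWith) fun y hy => hy

/-- Differentiability is a hypothesis since Rademacher's theorem supplies it a.e.; the value is then
read off along the ray, where `log ‖x + t x‖ = log (1 + t) + log ‖x‖`. -/
theorem fderiv_regularizedPower_self {n : ℕ} (A B : ℝ) {η : ℝ} (hη : 0 < η)
    {q ξ : EuclideanSpace ℝ (Fin n) → ℝ} (hq : ContDiff ℝ ∞ q)
    {x : EuclideanSpace ℝ (Fin n)} (hx : x ≠ 0) (hξ : DifferentiableAt ℝ ξ x)
    (hf : DifferentiableAt ℝ (regularizedPower A B η q ξ) x) :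
    fderiv ℝ (regularizedPower A B η q ξ) x x =
      Real.exp ((A * q x + B) * Real.log ‖x‖) *
        ((A * fderiv ℝ q x x * Real.log ‖x‖ + (A * q x + B)) *
          (Real.exp (q x * (Real.log (ξ x ^ 2 + η ^ 2) / 2)) - Real.exp (q x * Real.log η)) +
        (fderiv ℝ q x x * (Real.log (ξ x ^ 2 + η ^ 2) / 2) +
          q x * (ξ x * fderiv ℝ ξ x x / (ξ x ^ 2 + η ^ 2))) *
          Real.exp (q x * (Real.log (ξ x ^ 2 + η ^ 2) / 2)) -
        fderiv ℝ q x x * Real.log η * Real.exp (q x * Real.log η)) := by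
  have hl := (hf.hasFDerivAt.hasLineDerivAt x)
  have hq' : HasDerivAt (fun t : ℝ => q (x + t • x)) (fderiv ℝ q x x) 0 :=
    ((hq.differentiable (by simp)) x).hasFDerivAt.hasLineDerivAt x
  have hξ' : HasDerivAt (fun t : ℝ => ξ (x + t • x)) (fderiv ℝ ξ x x) 0 :=
    hξ.hasFDerivAt.hasLineDerivAt x
  have hn : HasDerivAt (fun t : ℝ => Real.log ‖x + t • x‖) 1 0 := by
    have h1 : HasDerivAt (fun t : ℝ => Real.log (1 + t) + Real.log ‖x‖) 1 0 := by
      have := (((hasDerivAt_id (0 : ℝ)).const_add 1).log (by norm_num)).add_const (Real.log ‖x‖)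
      simpa using this
    refine h1.congr_of_eventuallyEq ?_
    filter_upwards [lt_mem_nhds (show (-1 : ℝ) < 0 by norm_num)] with t ht
    have h2 : x + t • x = (1 + t) • x := by rw [add_smul, one_smul]
    rw [h2, norm_smul, Real.log_mul (by simp; linarith) (by simpa using hx), Real.norm_eq_abs,
      Real.log_abs]
  have hp : ξ x ^ 2 + η ^ 2 ≠ 0 := by positivity
  have hL : HasDerivAt (fun t : ℝ => Real.log (ξ (x + t • x) ^ 2 + η ^ 2) / 2)
      (ξ x * fderiv ℝ ξ x x / (ξ x ^ 2 + η ^ 2)) 0 := by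
    have := (((hξ'.pow 2).add_const (η ^ 2)).log (by simpa using hp)).div_const 2
    refine this.congr_deriv ?_
    simp; ring
  have hW := (((hq'.const_mul A).add_const B).mul hn).exp
  have hB := (hq'.mul hL).exp.sub (hq'.mul_const (Real.log η)).exp
  have hfin := hW.mul hB
  have := hfin.unique hl
  rw [← this]
  simp
  ring

theorem Real.exp_mul_log_le {u T q b : ℝ} (hu : 0 < u) (huT : u ≤ T) (hT : 1 ≤ T) (hq : 0 ≤ q)
    (hqb : q ≤ b) : Real.exp (q * Real.log u) ≤ T ^ b := by
  rw [mul_comm, ← Real.rpow_def_of_pos hu]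
  exact (Real.rpow_le_rpow hu.le huT hq).trans (Real.rpow_le_rpow_of_exponent_le hT hqb)

/-- Since `|log u| ≤ u + 1/u`, the logarithm shifts the exponent by one either way, and `q ≥ 1`
keeps `q - 1` nonnegative. -/
theorem Real.abs_log_mul_exp_mul_log_le {u T q b : ℝ} (hu : 0 < u) (huT : u ≤ T) (hT : 1 ≤ T)
    (hq : 1 ≤ q) (hqb : q ≤ b) :
    |Real.log u| * Real.exp (q * Real.log u) ≤ 2 * T ^ (b + 1) := by
  have h1 : |Real.log u| ≤ u + u⁻¹ := by
    have h2 := Real.log_le_self hu.le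
    have h3 := Real.log_le_self (inv_pos.2 hu).le
    rw [Real.log_inv] at h3
    have := inv_pos.2 hu
    rw [abs_le]; constructor <;> linarith
  have h4 : Real.exp ((q + 1) * Real.log u) ≤ T ^ (b + 1) :=
    Real.exp_mul_log_le hu huT hT (by linarith) (by linarith)
  have h5 : Real.exp ((q - 1) * Real.log u) ≤ T ^ (b + 1) :=
    Real.exp_mul_log_le hu huT hT (by linarith) (by linarith)
  have h6 : Real.exp ((q + 1) * Real.log u) = u * Real.exp (q * Real.log u) := by
    rw [add_mul, one_mul, Real.exp_add, Real.exp_log hu, mul_comm]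
  have h7 : Real.exp ((q - 1) * Real.log u) = u⁻¹ * Real.exp (q * Real.log u) := by
    rw [sub_mul, one_mul, Real.exp_sub, Real.exp_log hu]; field_simp
  calc _ ≤ (u + u⁻¹) * Real.exp (q * Real.log u) := by gcongr
    _ = Real.exp ((q + 1) * Real.log u) + Real.exp ((q - 1) * Real.log u) := by
      rw [h6, h7]; ring
    _ ≤ _ := by linarith

theorem tendsto_exp_mul_log {u q : ℕ → ℝ} {u₀ p : ℝ} (hu : ∀ k, 0 < u k)
    (hu₀ : Tendsto u atTop (𝓝 u₀)) (hq : Tendsto q atTop (𝓝 p)) (hp : 0 < p) :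
    Tendsto (fun k => Real.exp (q k * Real.log (u k))) atTop (𝓝 (u₀ ^ p)) := by
  have h := (Real.continuousAt_rpow_of_pos (u₀, p) hp).tendsto.comp (hu₀.prodMk_nhds hq)
  refine h.congr fun k => ?_
  simp [Real.rpow_def_of_pos (hu k), mul_comm]

/-- Factor as `(u log u) u^(q - 1)`: the first factor is continuous at `0`, and `p > 1` makes the
second converge even when `u₀ = 0`. -/
theorem tendsto_log_mul_exp_mul_log {u q : ℕ → ℝ} {u₀ p : ℝ} (hu : ∀ k, 0 < u k)
    (hu₀ : Tendsto u atTop (𝓝 u₀)) (hq : Tendsto q atTop (𝓝 p)) (hp : 1 < p) :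
    Tendsto (fun k => Real.log (u k) * Real.exp (q k * Real.log (u k))) atTop
      (𝓝 (Real.log u₀ * u₀ ^ p)) := by
  have hu0 : 0 ≤ u₀ := ge_of_tendsto' hu₀ fun k => (hu k).le
  have h1 := tendsto_exp_mul_log hu hu₀ (hq.sub_const 1) (sub_pos.2 hp)
  have h2 := (Real.continuous_mul_log.tendsto u₀).comp hu₀
  have h3 := h2.mul h1
  have e : u₀ * Real.log u₀ * u₀ ^ (p - 1) = Real.log u₀ * u₀ ^ p := by
    rcases hu0.eq_or_lt with h | h
    · simp [← h]
    · rw [Real.rpow_sub_one h.ne']; field_simp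
  rw [← e]
  refine h3.congr fun k => ?_
  have := hu k
  simp only [Function.comp]
  rw [sub_mul, one_mul, Real.exp_sub, Real.exp_log this]
  field_simp

/-- The integrand `n f + ⟨∇f, x⟩` for the regularised power, as a function of the values at a
point: `ℓ` is `log ‖x‖`, `D` and `d` the radial derivatives of `q` and `ξ`. -/
noncomputable def powerDivergence (N A B ℓ η q D s d : ℝ) : ℝ :=
  N * (Real.exp ((A * q + B) * ℓ) *
    (Real.exp (q * (Real.log (s ^ 2 + η ^ 2) / 2)) - Real.exp (q * Real.log η))) +
  Real.exp ((A * q + B) * ℓ) *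
    ((A * D * ℓ + (A * q + B)) *
      (Real.exp (q * (Real.log (s ^ 2 + η ^ 2) / 2)) - Real.exp (q * Real.log η)) +
    (D * (Real.log (s ^ 2 + η ^ 2) / 2) + q * (s * d / (s ^ 2 + η ^ 2))) *
      Real.exp (q * (Real.log (s ^ 2 + η ^ 2) / 2)) -
    D * Real.log η * Real.exp (q * Real.log η))

theorem tendsto_powerDivergence (N A B ℓ s d : ℝ) {η q D : ℕ → ℝ} {p D₀ : ℝ}
    (hη : ∀ k, 0 < η k) (hη0 : Tendsto η atTop (𝓝 0)) (hq : Tendsto q atTop (𝓝 p))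
    (hp : 1 < p) (hD : Tendsto D atTop (𝓝 D₀)) :
    Tendsto (fun k => powerDivergence N A B ℓ (η k) (q k) (D k) s d) atTop
      (𝓝 (Real.exp ((A * p + B) * ℓ) * |s| ^ p *
        (N + (A * p + B) + A * ℓ * D₀ + p * (d / s) + D₀ * Real.log |s|))) := by
  set u : ℕ → ℝ := fun k => Real.sqrt (s ^ 2 + η k ^ 2) with hu
  have hu0 : ∀ k, 0 < u k := fun k => Real.sqrt_pos.2 (by have := hη k; positivity)
  have hut : Tendsto u atTop (𝓝 |s|) := by
    have := ((tendsto_const_nhds (x := s ^ 2)).add (hη0.pow 2)).sqrt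
    simpa [Real.sqrt_sq_eq_abs] using this
  have hlog : ∀ k, Real.log (s ^ 2 + η k ^ 2) / 2 = Real.log (u k) := fun k => by
    rw [Real.log_sqrt (by positivity)]
  have hE1 := tendsto_exp_mul_log hu0 hut hq (by linarith)
  have hE2 := tendsto_exp_mul_log hη hη0 hq (by linarith)
  have hF1 := tendsto_log_mul_exp_mul_log hu0 hut hq hp
  have hF2 := tendsto_log_mul_exp_mul_log hη hη0 hq hp
  rw [Real.zero_rpow (by linarith)] at hE2 hF2
  have hW : Tendsto (fun k => Real.exp ((A * q k + B) * ℓ)) atTop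
      (𝓝 (Real.exp ((A * p + B) * ℓ))) :=
    (Real.continuous_exp.tendsto _).comp (((hq.const_mul A).add_const B).mul_const ℓ)
  have hQ : Tendsto (fun k => q k * (s * d / (s ^ 2 + η k ^ 2)) *
      Real.exp (q k * Real.log (u k))) atTop (𝓝 (p * (d / s) * |s| ^ p)) := by
    -- At `s = 0` both sides vanish, with `d / 0 = 0`.
    by_cases hs : s = 0
    · simp [hs]
    · have h1 : Tendsto (fun k => s * d / (s ^ 2 + η k ^ 2)) atTop (𝓝 (d / s)) := by
        have := (tendsto_const_nhds (x := s * d) (f := (atTop : Filter ℕ))).div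
          ((tendsto_const_nhds (x := s ^ 2)).add (hη0.pow 2)) (by simpa using hs)
        have e : s * d / (s ^ 2 + 0 ^ 2) = d / s := by field_simp; simp; ring
        rwa [e] at this
      exact (hq.mul h1).mul hE1
  have h1 := (hW.mul (hE1.sub hE2)).const_mul N
  have h2 := ((((hD.const_mul A).mul_const ℓ).add ((hq.const_mul A).add_const B)).mul
    (hE1.sub hE2))
  have h3 := h1.add (hW.mul (((h2.add (hD.mul hF1)).add hQ).sub (hD.mul hF2)))
  convert h3 using 2
  · rw [powerDivergence, hlog]; ring
  · ring

/-- The bound is uniform in `η` and `q`, and affine in `|D|`: the derivative of the mollified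
exponent is the one quantity without a uniform bound. -/
theorem abs_powerDivergence_le {N A B ℓ η q D s d : ℝ} {b T Λ d₀ : ℝ} (hN : 0 ≤ N) (hη : 0 < η)
    (hη1 : η ≤ 1) (hq1 : 1 ≤ q) (hqb : q ≤ b) (hT : |s| + 1 ≤ T) (hℓ : |ℓ| ≤ Λ)
    (hd : |d| ≤ d₀) :
    |powerDivergence N A B ℓ η q D s d| ≤
      Real.exp ((|A| * b + |B|) * Λ) * T ^ b * (2 * N + 2 * (|A| * b + |B|) + b * d₀) +
      Real.exp ((|A| * b + |B|) * Λ) * (2 * |A| * Λ * T ^ b + 4 * T ^ (b + 1)) * |D| := by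
  set u := Real.sqrt (s ^ 2 + η ^ 2) with hu
  have hs0 := abs_nonneg s
  have hT1 : 1 ≤ T := by linarith
  have hu0 : 0 < u := Real.sqrt_pos.2 (by positivity)
  have husq : u ^ 2 = s ^ 2 + η ^ 2 := Real.sq_sqrt (by positivity)
  have huT : u ≤ T := by
    refine le_trans ?_ hT
    rw [hu]
    refine Real.sqrt_le_iff.2 ⟨by positivity, ?_⟩
    nlinarith [sq_abs s]
  have hsu : |s| ≤ u := by
    rw [hu]; apply Real.abs_le_sqrt; nlinarith
  have hlog : Real.log (s ^ 2 + η ^ 2) / 2 = Real.log u := by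
    rw [hu, Real.log_sqrt (by positivity)]
  rw [powerDivergence, hlog, ← husq]
  have hW0 : |A * q + B| ≤ |A| * b + |B| := by
    refine (abs_add_le _ _).trans ?_
    rw [abs_mul, abs_of_nonneg (by linarith : 0 ≤ q)]
    gcongr
  have hΛ : 0 ≤ Λ := (abs_nonneg _).trans hℓ
  have hd0 : 0 ≤ d₀ := (abs_nonneg _).trans hd
  have hb : 1 ≤ b := hq1.trans hqb
  have hW : Real.exp ((A * q + B) * ℓ) ≤ Real.exp ((|A| * b + |B|) * Λ) := by
    refine Real.exp_le_exp.2 ((le_abs_self _).trans ?_)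
    rw [abs_mul]; gcongr
  have hE1 := Real.exp_mul_log_le hu0 huT hT1 (by linarith) hqb
  have hE2 := Real.exp_mul_log_le hη (hη1.trans hT1) hT1 (by linarith) hqb
  have hF1 := Real.abs_log_mul_exp_mul_log_le hu0 huT hT1 hq1 hqb
  have hF2 := Real.abs_log_mul_exp_mul_log_le hη (hη1.trans hT1) hT1 hq1 hqb
  -- Here `s d u^(q - 2) = (s / u) d u^(q - 1)` with `|s| ≤ u` and `q ≥ 1`, so nothing blows up as
  -- `η → 0`.
  have hQ : |s * d / u ^ 2 * Real.exp (q * Real.log u)| ≤ d₀ * T ^ b := by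
    have h5 : Real.exp ((q - 1) * Real.log u) ≤ T ^ b :=
      Real.exp_mul_log_le hu0 huT hT1 (by linarith) (by linarith)
    have h7 : Real.exp ((q - 1) * Real.log u) = u⁻¹ * Real.exp (q * Real.log u) := by
      rw [sub_mul, one_mul, Real.exp_sub, Real.exp_log hu0]; field_simp
    have e : s * d / u ^ 2 * Real.exp (q * Real.log u) =
        (s / u) * (d * Real.exp ((q - 1) * Real.log u)) := by
      rw [h7]; field_simp
    rw [e, abs_mul, abs_mul, abs_div, abs_of_pos hu0, Real.abs_exp]
    have h8 : |s| / u ≤ 1 := (div_le_one hu0).2 hsu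
    calc |s| / u * (|d| * Real.exp ((q - 1) * Real.log u)) ≤ 1 * (d₀ * T ^ b) := by gcongr
      _ = _ := one_mul _
  set W := Real.exp ((A * q + B) * ℓ)
  set W' := Real.exp ((|A| * b + |B|) * Λ)
  set X := Real.exp (q * Real.log u)
  set Y := Real.exp (q * Real.log η)
  have hX : 0 < X := Real.exp_pos _
  have hY : 0 < Y := Real.exp_pos _
  have hWp : 0 < W := Real.exp_pos _
  have hXY : |X - Y| ≤ 2 * T ^ b := by rw [abs_le]; constructor <;> linarith
  have e : N * (W * (X - Y)) + W * ((A * D * ℓ + (A * q + B)) * (X - Y) +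
      (D * Real.log u + q * (s * d / u ^ 2)) * X - D * Real.log η * Y) =
      W * ((N + (A * q + B)) * (X - Y) + q * (s * d / u ^ 2 * X) +
        (A * ℓ * (X - Y) + Real.log u * X - Real.log η * Y) * D) := by ring
  have hTb : 0 ≤ T ^ b := by positivity
  have b1 : |(N + (A * q + B)) * (X - Y)| ≤ (N + (|A| * b + |B|)) * (2 * T ^ b) := by
    rw [abs_mul]
    have : |N + (A * q + B)| ≤ N + (|A| * b + |B|) := by
      refine (abs_add_le _ _).trans ?_
      rw [abs_of_nonneg hN]; gcongr
    gcongr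
  have b2 : |q * (s * d / u ^ 2 * X)| ≤ b * (d₀ * T ^ b) := by
    rw [abs_mul, abs_of_nonneg (by linarith : 0 ≤ q)]
    gcongr
  have b3 : |A * ℓ * (X - Y) + Real.log u * X - Real.log η * Y| ≤
      |A| * Λ * (2 * T ^ b) + 2 * T ^ (b + 1) + 2 * T ^ (b + 1) := by
    refine (abs_sub _ _).trans (add_le_add ((abs_add_le _ _).trans (add_le_add ?_ ?_)) ?_)
    · rw [abs_mul, abs_mul]; gcongr
    · rwa [abs_mul, abs_of_pos hX]
    · rwa [abs_mul, abs_of_pos hY]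
  rw [e, abs_mul, abs_of_pos hWp]
  calc W * |_| ≤ W' * ((N + (|A| * b + |B|)) * (2 * T ^ b) + b * (d₀ * T ^ b) +
        (|A| * Λ * (2 * T ^ b) + 2 * T ^ (b + 1) + 2 * T ^ (b + 1)) * |D|) := by
        gcongr
        refine (abs_add_le _ _).trans (add_le_add ((abs_add_le _ _).trans (add_le_add b1 b2)) ?_)
        rw [abs_mul]; gcongr
    _ = _ := by ring

/-! ### The divergence identity. -/

/-- The divergence `∫ div (‖x‖ ^ (A p + B) |ξ| ^ p x) = 0` for a weakly differentiable exponent,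
with the divergence written out. -/
theorem IsWeakGradientOn.integral_div_rpow_eq_zero {n : ℕ} {Ω : Set (EuclideanSpace ℝ (Fin n))}
    (hΩ : IsOpen Ω) (h0 : Ω ⊆ {0}ᶜ) {p : EuclideanSpace ℝ (Fin n) → ℝ}
    {g : EuclideanSpace ℝ (Fin n) → EuclideanSpace ℝ (Fin n)} (hpg : IsWeakGradientOn Ω p g)
    {a b : ℝ} (ha : 1 < a) (hab : ∀ᵐ x ∂(volume.restrict Ω), a ≤ p x ∧ p x ≤ b)
    {ξ : EuclideanSpace ℝ (Fin n) → ℝ} {C : NNReal} (hξ : LipschitzWith C ξ)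
    (hc : HasCompactSupport ξ) (hsupp : tsupport ξ ⊆ Ω) (A B : ℝ) :
    IntegrableOn (fun x => Real.exp ((A * p x + B) * Real.log ‖x‖) * |ξ x| ^ p x *
      (n + (A * p x + B) + A * Real.log ‖x‖ * inner ℝ (g x) x + p x * (fderiv ℝ ξ x x / ξ x) +
        inner ℝ (g x) x * Real.log |ξ x|)) Ω volume ∧
    ∫ x in Ω, Real.exp ((A * p x + B) * Real.log ‖x‖) * |ξ x| ^ p x *
      (n + (A * p x + B) + A * Real.log ‖x‖ * inner ℝ (g x) x + p x * (fderiv ℝ ξ x x / ξ x) +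
        inner ℝ (g x) x * Real.log |ξ x|) = 0 := by
  set J : EuclideanSpace ℝ (Fin n) → ℝ := fun x =>
    Real.exp ((A * p x + B) * Real.log ‖x‖) * |ξ x| ^ p x *
      (n + (A * p x + B) + A * Real.log ‖x‖ * inner ℝ (g x) x + p x * (fderiv ℝ ξ x x / ξ x) +
        inner ℝ (g x) x * Real.log |ξ x|) with hJ
  set S := tsupport ξ with hSdef
  have hS : IsCompact S := hc
  have hSm : MeasurableSet S := hS.measurableSet
  have hS0 : ∀ x ∈ S, x ≠ 0 := fun x hx => h0 (hsupp hx)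
  have h0S : (0 : EuclideanSpace ℝ (Fin n)) ∉ tsupport ξ := fun h => hS0 0 h rfl
  obtain ⟨q, h, h', hqs, hqab, hqh, hh0, hhi, hhi', hht, hhint, hqt, hDt⟩ :=
    hpg.exists_smooth_approx hΩ hab hS hsupp
  obtain ⟨M, hM⟩ := hc.exists_bound_of_continuous hξ.continuous
  have hM0 : 0 ≤ M := (norm_nonneg _).trans (hM 0)
  obtain ⟨Λ, hΛ⟩ := hS.exists_bound_of_continuousOn (f := fun x => Real.log ‖x‖)
    (continuousOn_id.norm.log fun x hx => by simpa using hS0 x hx)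
  obtain ⟨R, hR0, hR⟩ := hS.isBounded.exists_pos_norm_le
  set η : ℕ → ℝ := fun k => 1 / ((k : ℝ) + 1) with hη
  have hηp : ∀ k, 0 < η k := fun k => Nat.one_div_pos_of_nat
  have hη1 : ∀ k, η k ≤ 1 := fun k => by
    simp only [hη]; rw [div_le_one (by positivity)]; linarith [(Nat.cast_nonneg k : (0 : ℝ) ≤ k)]
  have hηt : Tendsto η atTop (𝓝 0) := tendsto_one_div_add_atTop_nhds_zero_nat
  set f : ℕ → EuclideanSpace ℝ (Fin n) → ℝ := fun k => regularizedPower A B (η k) (q k) ξ with hf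
  have hflip : ∀ k, ∃ K : NNReal, LipschitzWith K (f k) := fun k =>
    exists_lipschitzWith_regularizedPower A B (hηp k) (hqs k) hξ hc h0S
  have hfsupp : ∀ k, tsupport (f k) ⊆ S := fun k => tsupport_regularizedPower_subset A B _ _ _
  have hfc : ∀ k, HasCompactSupport (f k) := fun k =>
    HasCompactSupport.of_support_subset_isCompact hS ((subset_tsupport _).trans (hfsupp k))
  set F : ℕ → EuclideanSpace ℝ (Fin n) → ℝ := fun k x => (n : ℝ) * f k x + fderiv ℝ (f k) x x with hF
  have hF0 : ∀ k, ∫ x, F k x = 0 := fun k => by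
    obtain ⟨K, hK⟩ := hflip k
    exact integral_add_fderiv_self_eq_zero hK (hfc k)
  have hFS : ∀ k, ∀ x ∉ S, F k x = 0 := by
    intro k x hx
    have h1 : f k x = 0 := image_eq_zero_of_notMem_tsupport fun h => hx (hfsupp k h)
    have h2 : fderiv ℝ (f k) x = 0 := by
      by_contra h
      exact hx (hfsupp k (support_fderiv_subset ℝ h))
    simp [F, h1, h2]
  have hFm : ∀ k, AEStronglyMeasurable (F k) volume := by
    intro k
    obtain ⟨K, hK⟩ := hflip k
    have h1 : Measurable fun x => fderiv ℝ (f k) x x :=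
      (isBoundedBilinearMap_apply.continuous.measurable).comp
        ((measurable_fderiv ℝ (f k)).prodMk measurable_id)
    exact ((hK.continuous.measurable.const_mul _).add h1).aestronglyMeasurable
  have hdiff : ∀ᵐ x, ∀ k, DifferentiableAt ℝ (f k) x := by
    refine ae_all_iff.2 fun k => ?_
    obtain ⟨K, hK⟩ := hflip k
    exact hK.ae_differentiableAt
  have hFeq : ∀ᵐ x, x ∈ S → ∀ k, F k x = powerDivergence n A B (Real.log ‖x‖) (η k) (q k x)
      (fderiv ℝ (q k) x x) (ξ x) (fderiv ℝ ξ x x) := by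
    filter_upwards [hdiff, hξ.ae_differentiableAt] with x h1 h2 hx k
    simp only [F, f]
    rw [fderiv_regularizedPower_self A B (hηp k) (hqs k) (hS0 x hx) h2 (h1 k)]
    rfl
  set M₁ := Real.exp ((|A| * b + |B|) * |Λ|) * (M + 1) ^ b *
    (2 * n + 2 * (|A| * b + |B|) + b * (C * R))
  set M₂ := Real.exp ((|A| * b + |B|) * |Λ|) *
    (2 * |A| * |Λ| * (M + 1) ^ b + 4 * (M + 1) ^ (b + 1)) with hM₂
  have hM₂0 : 0 ≤ M₂ := by positivity
  have hbound : ∀ k, ∀ᵐ x, |F k x| ≤ S.indicator (fun _ => M₁) x + M₂ * R * h k x := by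
    intro k
    filter_upwards [hFeq] with x hx
    by_cases hxS : x ∈ S
    · rw [hx hxS k, indicator_of_mem hxS]
      have h1 := abs_powerDivergence_le (N := n) (A := A) (B := B) (ℓ := Real.log ‖x‖)
        (D := fderiv ℝ (q k) x x) (s := ξ x) (d := fderiv ℝ ξ x x) (T := M + 1) (Λ := |Λ|)
        (d₀ := C * R) n.cast_nonneg (hηp k) (hη1 k)
        (ha.le.trans (hqab k x hxS).1) (hqab k x hxS).2 (by simpa using hM x)
        ((hΛ x hxS).trans (le_abs_self _)) ?_
      · refine h1.trans (add_le_add le_rfl ?_)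
        rw [mul_assoc M₂]
        refine mul_le_mul_of_nonneg_left ?_ hM₂0
        refine ((fderiv ℝ (q k) x).le_opNorm x).trans ?_
        rw [mul_comm]
        gcongr
        exacts [hR x hxS, hqh k x hxS]
      · refine ((fderiv ℝ ξ x).le_opNorm x).trans ?_
        gcongr
        exacts [norm_fderiv_le_of_lipschitz ℝ hξ, hR x hxS]
    · rw [hFS k x hxS, indicator_of_notMem hxS, abs_zero, zero_add]
      have := hh0 k x
      positivity
  have hind : Integrable (S.indicator fun _ => M₁) volume :=
    (integrable_indicator_iff hSm).2 (integrableOn_const hS.measure_lt_top.ne)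
  have hlim : ∀ᵐ x, Tendsto (fun k => F k x) atTop (𝓝 (S.indicator J x)) := by
    filter_upwards [hFeq, hqt, hDt, (ae_restrict_iff' hΩ.measurableSet).1 hab] with x h1 h2 h3 h4
    by_cases hxS : x ∈ S
    · rw [indicator_of_mem hxS]
      simp only [h1 hxS]
      exact tendsto_powerDivergence n A B (Real.log ‖x‖) (ξ x) (fderiv ℝ ξ x x) hηp hηt (h2 hxS)
        (ha.trans_le (h4 (hsupp hxS)).1) (h3 hxS x)
    · rw [indicator_of_notMem hxS]
      simp only [hFS _ x hxS]
      exact tendsto_const_nhds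
  obtain ⟨hi, ht⟩ := tendsto_integral_of_varying_dominated hFm
    (fun k => hind.add ((hhi k).const_mul (M₂ * R))) (hind.add (hhi'.const_mul (M₂ * R)))
    hbound hlim (by
      filter_upwards [hht] with x hx
      exact (hx.const_mul _).const_add _) (by
      have e1 : ∀ k, ∫ x, (S.indicator (fun _ => M₁) + fun x => M₂ * R * h k x) x =
          (∫ x, S.indicator (fun _ => M₁) x) + M₂ * R * ∫ x, h k x := fun k => by
        rw [integral_add' hind ((hhi k).const_mul _), integral_const_mul]
      have e2 : ∫ x, (S.indicator (fun _ => M₁) + fun x => M₂ * R * h' x) x =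
          (∫ x, S.indicator (fun _ => M₁) x) + M₂ * R * ∫ x, h' x := by
        rw [integral_add' hind (hhi'.const_mul _), integral_const_mul]
      simp only [e1, e2]
      exact (hhint.const_mul _).const_add _)
  simp only [hF0] at ht
  have hJ0 : ∀ᵐ x ∂(volume.restrict Ω), S.indicator J x = J x := by
    filter_upwards [hab] with x hx
    by_cases hxS : x ∈ S
    · rw [indicator_of_mem hxS]
    · have h1 : ξ x = 0 := image_eq_zero_of_notMem_tsupport hxS
      have h2 : p x ≠ 0 := by linarith [hx.1]
      simp [J, h1, Real.zero_rpow h2, indicator_of_notMem hxS]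
  refine ⟨hi.integrableOn.congr hJ0, ?_⟩
  rw [← integral_congr_ae hJ0, setIntegral_eq_integral_of_forall_compl_eq_zero]
  · exact (tendsto_nhds_unique ht tendsto_const_nhds)
  · exact fun x hx => indicator_of_notMem (fun h => hx (hsupp h)) _

/-! ### Young's inequality and the pointwise estimate. -/

/-- Bernoulli's inequality `(tY)^p ≥ 1 + p(tY - 1)`, divided by the free parameter `Y`. -/
theorem Real.mul_le_sub_one_div_add_rpow_mul {p t Y : ℝ} (hp : 1 < p) (ht : 0 ≤ t) (hY : 0 < Y) :
    p * t ≤ (p - 1) / Y + t ^ p * Y ^ (p - 1) := by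
  have h1 := one_add_mul_self_le_rpow_one_add (s := t * Y - 1) (by nlinarith) hp.le
  rw [add_sub_cancel, Real.mul_rpow ht hY.le] at h1
  have h2 : Y ^ (p - 1) = Y ^ p / Y := Real.rpow_sub_one hY.ne' p
  rw [h2, ← mul_div_assoc, ← add_div, le_div_iff₀ hY]
  linarith

/-- The pointwise inequality behind the weighted Hardy inequality: Young's inequality is applied
to the terms with the radial derivatives `d` of `ξ` and `D` of `p`. -/
theorem powerWeight_pointwise_le {n α β σ p X ξ N G D d : ℝ} (hα : 0 < α) (hσ : σ < β)
    (hp : 1 < p) (hX : 0 < X) (hG : 0 ≤ G) (hN : 0 ≤ N) (hd : |d| ≤ N * X) (hD : |D| ≤ G * X) :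
    |ξ| ^ p * (X ^ (α * (p - β - 1) - p) *
        (α * (σ - 1 / α * ((α - 1) * (D * Real.log X + p) + n - α)))) +
      Real.exp (((α - 1) * p + -(α * (β + 1))) * Real.log X) * |ξ| ^ p *
        (n + ((α - 1) * p + -(α * (β + 1))) + (α - 1) * Real.log X * D + p * (d / ξ) +
          D * Real.log |ξ|) ≤
    N ^ p * (X ^ (α * (p - β - 1)) * (2 / α * ((p - 1) / (β - σ))) ^ (p - 1)) +
      |ξ * Real.log (|ξ|)| ^ p * (G ^ p / p ^ p) *
        (X ^ (α * (p - β - 1)) * (2 / α * ((p - 1) / (β - σ))) ^ (p - 1)) := by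
  have hδ : 0 < β - σ := sub_pos.2 hσ
  have hp1 : 0 < p - 1 := sub_pos.2 hp
  have hp0 : 0 < p := by linarith
  set Y := 2 / α * ((p - 1) / (β - σ)) with hYdef
  have hY : 0 < Y := by positivity
  by_cases hξ : ξ = 0
  · rw [hξ, abs_zero, Real.zero_rpow hp0.ne']
    simp only [zero_mul, mul_zero, add_zero]
    positivity
  set s := |ξ| with hs
  have hs0 : 0 < s := abs_pos.2 hξ
  have he : Real.exp (((α - 1) * p + -(α * (β + 1))) * Real.log X) =
      X ^ (α * (p - β - 1) - p) := by
    rw [Real.rpow_def_of_pos hX]; congr 1; ring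
  have hw : X ^ (α * (p - β - 1)) = X ^ (α * (p - β - 1) - p) * X ^ p := by
    rw [← Real.rpow_add hX]; congr 1; ring
  rw [he, hw]
  set W := X ^ (α * (p - β - 1) - p)
  have hW : 0 < W := Real.rpow_pos_of_pos hX _
  -- This explains the constant in `μ_{2,β}`: each of the two uses of Young's inequality may spend
  -- half of `α(β - σ)`.
  have hYinv : (p - 1) / Y = α * (β - σ) / 2 := by
    rw [hYdef]; field_simp
  set t₁ := N * X / s with ht₁
  set t₂ := G * X * |Real.log s| / p with ht₂
  have y₁ := Real.mul_le_sub_one_div_add_rpow_mul hp (t := t₁) (by positivity) hY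
  have y₂ := Real.mul_le_sub_one_div_add_rpow_mul hp (t := t₂) (by positivity) hY
  rw [hYinv] at y₁ y₂
  have d₁ : p * (d / ξ) ≤ p * t₁ := by
    refine mul_le_mul_of_nonneg_left ((le_abs_self _).trans ?_) hp0.le
    rw [abs_div]; exact div_le_div_of_nonneg_right hd hs0.le
  have d₂ : D * Real.log s ≤ p * t₂ := by
    have : p * t₂ = G * X * |Real.log s| := by rw [ht₂]; field_simp
    rw [this]
    refine (le_abs_self _).trans ?_
    rw [abs_mul]; gcongr
  have e₁ : s ^ p * t₁ ^ p = N ^ p * X ^ p := by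
    rw [← Real.mul_rpow hs0.le (by positivity), ← Real.mul_rpow hN hX.le]
    congr 1; rw [ht₁]; field_simp
  have e₂ : s ^ p * t₂ ^ p = |ξ * Real.log s| ^ p * (G ^ p / p ^ p) * X ^ p := by
    rw [← Real.mul_rpow hs0.le (by positivity), ← Real.div_rpow hG hp0.le,
      ← Real.mul_rpow (abs_nonneg _) (by positivity), ← Real.mul_rpow (by positivity) hX.le]
    congr 1; rw [ht₂, abs_mul, ← hs]; field_simp
  have hα' : α * (σ - 1 / α * ((α - 1) * (D * Real.log X + p) + n - α)) =
      α * σ - ((α - 1) * (D * Real.log X + p) + n - α) := by field_simp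
  rw [hα']
  calc _ = W * s ^ p * (-(α * (β - σ)) + p * (d / ξ) + D * Real.log s) := by ring
    _ ≤ W * s ^ p * (t₁ ^ p * Y ^ (p - 1) + t₂ ^ p * Y ^ (p - 1)) := by
      refine mul_le_mul_of_nonneg_left ?_ (by positivity)
      linarith
    _ = W * (s ^ p * t₁ ^ p) * Y ^ (p - 1) + W * (s ^ p * t₂ ^ p) * Y ^ (p - 1) := by ring
    _ = _ := by rw [e₁, e₂]; ring

/-! ### Integrability and the Hardy inequality. -/

theorem Real.rpow_le_rpow_of_bounds {y Y q b : ℝ} (hy : 0 ≤ y) (hyY : y ≤ Y) (hY : 1 ≤ Y)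
    (hq : 0 ≤ q) (hqb : q ≤ b) : y ^ q ≤ Y ^ b :=
  (Real.rpow_le_rpow hy hyY hq).trans (Real.rpow_le_rpow_of_exponent_le hY hqb)

theorem Real.rpow_le_exp_of_abs_log_le {X q Λ b : ℝ} (hX : 0 < X) (hΛ : |Real.log X| ≤ Λ)
    (hq : |q| ≤ b) : X ^ q ≤ Real.exp (Λ * b) := by
  rw [Real.rpow_def_of_pos hX]
  refine Real.exp_le_exp.2 ((le_abs_self _).trans ?_)
  rw [abs_mul]
  have := (abs_nonneg _).trans hΛ
  gcongr

/-- A function vanishing off a compact set and bounded by a locally integrable function is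
integrable. -/
theorem MeasureTheory.LocallyIntegrableOn.integrableOn_of_bound {E : Type*}
    [NormedAddCommGroup E] [MeasurableSpace E] [BorelSpace E] {μ : Measure E} {Ω S : Set E}
    {F u : E → ℝ} {c : ℝ} (hu : LocallyIntegrableOn u Ω μ) (hS : IsCompact S) (hSΩ : S ⊆ Ω)
    (hF : AEStronglyMeasurable F (μ.restrict Ω))
    (hb : ∀ᵐ x ∂(μ.restrict Ω), x ∈ S → |F x| ≤ c * u x)
    (hz : ∀ᵐ x ∂(μ.restrict Ω), x ∉ S → F x = 0) : IntegrableOn F Ω μ := by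
  have hSm := hS.measurableSet
  have h1 : IntegrableOn F S μ := by
    refine ((hu.integrableOn_compact_subset hSΩ hS).const_mul c).mono' (hF.mono_set hSΩ) ?_
    filter_upwards [ae_restrict_of_ae_restrict_of_subset hSΩ hb, ae_restrict_mem hSm] with x hx hxS
    exact hx hxS
  refine ((integrable_indicator_iff hSm).2 h1).integrableOn.congr ?_
  filter_upwards [hz] with x hx
  by_cases hxS : x ∈ S
  · rw [indicator_of_mem hxS]
  · rw [indicator_of_notMem hxS, hx hxS]

end Auxiliary

theorem mainTheorem4 {n : ℕ} (Ω : Set (EuclideanSpace ℝ (Fin n)))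
    (hΩ : IsOpen Ω) (hΩ0 : Ω ⊆ {0}ᶜ)
    (p : EuclideanSpace ℝ (Fin n) → ℝ)
    (gradp : EuclideanSpace ℝ (Fin n) → EuclideanSpace ℝ (Fin n))
    (hp : IsExponentOn Ω p gradp)
    (α β C_L : ℝ) (hα : 0 < α) (hβ : 0 < β)
    (hCL : (∀ᵐ x ∂(volume.restrict Ω), C_L ≤ gradLogTerm gradp x) ∨
      (∀ᵐ x ∂(volume.restrict Ω), gradLogTerm gradp x ≤ C_L))
    (σ : EuclideanSpace ℝ (Fin n) → ℝ) (hσ : AEMeasurable σ (volume.restrict Ω))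
    (hσβ : ∃ s < β, ∀ x ∈ Ω, σ x ≤ s)
    (hσp : ∀ᵐ x ∂(volume.restrict Ω),
      (α - 1) * C_L ≤ α * σ x - n + α - p x * (α - 1)) :
    VariableHardyInequality Ω p gradp
        (powerWeight₁ α β σ p gradp) (powerWeight₂ α β σ p) ∧
      (((1 ≤ α ∧ ∀ᵐ x ∂(volume.restrict Ω), gradLogTerm gradp x ≤ C_L) ∨
          (α < 1 ∧ ∀ᵐ x ∂(volume.restrict Ω), C_L ≤ gradLogTerm gradp x)) →
        ∀ᵐ x ∂(volume.restrict Ω), 0 ≤ powerK α σ p gradp x) := by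
  obtain ⟨a, b, ha, hab⟩ := hp.essBounds
  obtain ⟨s₀, hs₀, hσs⟩ := hσβ
  have hmem : ∀ᵐ x ∂(volume.restrict Ω), x ∈ Ω := ae_restrict_mem hΩ.measurableSet
  refine ⟨?_, ?_⟩
  · rintro ξ ⟨C₀, hξ₀⟩ hc hsupp
    obtain ⟨C, hξ⟩ := hc.exists_lipschitzWith fun x hx =>
      ⟨C₀, Ω, hΩ.mem_nhds (hsupp hx), hξ₀⟩
    obtain ⟨hJi, hJ0⟩ := hp.weakGradient.integral_div_rpow_eq_zero hΩ hΩ0 ha hab hξ hc hsupp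
      (α - 1) (-(α * (β + 1)))
    have hS : IsCompact (tsupport ξ) := hc
    have hX : ∀ x ∈ Ω, 0 < ‖x‖ := fun x hx => norm_pos_iff.2 (hΩ0 hx)
    obtain ⟨M, hM⟩ := hc.exists_bound_of_continuous hξ.continuous
    obtain ⟨M', hM'⟩ := hS.exists_bound_of_continuousOn (f := fun x => ξ x * Real.log (ξ x))
      (Real.continuous_mul_log.comp hξ.continuous).continuousOn
    obtain ⟨Λ, hΛ⟩ := hS.exists_bound_of_continuousOn (f := fun x => Real.log ‖x‖)
      (continuousOn_id.norm.log fun x hx => (hX x (hsupp hx)).ne')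
    obtain ⟨R, hR0, hR⟩ := hS.isBounded.exists_pos_norm_le
    have hpm : AEMeasurable p (volume.restrict Ω) :=
      hp.weakGradient.locallyIntegrableOn.aestronglyMeasurable.aemeasurable
    have hgm : AEMeasurable gradp (volume.restrict Ω) :=
      hp.weakGradient.locallyIntegrableOn_grad.aestronglyMeasurable.aemeasurable
    have hξm : AEMeasurable ξ (volume.restrict Ω) := hξ.continuous.aemeasurable
    have hnm : AEMeasurable (fun x : EuclideanSpace ℝ (Fin n) => ‖x‖) (volume.restrict Ω) :=
      continuous_norm.aemeasurable
    have hgrad : ∀ x, ‖gradient ξ x‖ = ‖fderiv ℝ ξ x‖ := fun x => by simp [gradient]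
    have hdm : AEMeasurable (fun x => ‖gradient ξ x‖) (volume.restrict Ω) := by
      simp only [hgrad]
      exact (measurable_fderiv ℝ ξ).norm.aemeasurable
    have hdle : ∀ x, ‖gradient ξ x‖ ≤ C := fun x => by
      rw [hgrad]; exact norm_fderiv_le_of_lipschitz ℝ hξ
    have hw₁m : AEMeasurable (powerWeight₁ α β σ p gradp) (volume.restrict Ω) := by
      unfold powerWeight₁ powerK gradLogTerm
      fun_prop
    have hw₂m : AEMeasurable (powerWeight₂ α β σ p) (volume.restrict Ω) := by
      unfold powerWeight₂
      fun_prop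
    -- Bounds `powerWeight₂` on the support, using `p ≤ b` and `σ ≤ s₀ < β`; the maximum with `1`
    -- allows the exponent `p - 1` to be raised to `b`.
    set W := Real.exp (Λ * (α * (|b| + β + 1))) *
      (max 1 (2 / α * ((b - 1) / (β - s₀)))) ^ b with hW
    have hw₂0 : ∀ᵐ x ∂(volume.restrict Ω), 0 ≤ powerWeight₂ α β σ p x := by
      filter_upwards [hab, hmem] with x hx hxΩ
      have h1 : 0 < β - σ x := by linarith [hσs x hxΩ]
      have h2 : 0 ≤ p x - 1 := by linarith [hx.1]
      unfold powerWeight₂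
      positivity
    have hw₂b : ∀ᵐ x ∂(volume.restrict Ω), x ∈ tsupport ξ → powerWeight₂ α β σ p x ≤ W := by
      filter_upwards [hab, hmem] with x hx hxΩ hxS
      have h1 : 0 < β - s₀ := by linarith
      have h1' : β - s₀ ≤ β - σ x := by linarith [hσs x hxΩ]
      have h2 : 0 ≤ p x - 1 := by linarith [hx.1]
      refine mul_le_mul ?_ ?_ (by have := h1.trans_le h1'; positivity) (Real.exp_pos _).le
      · refine Real.rpow_le_exp_of_abs_log_le (hX x hxΩ) (hΛ x hxS) ?_
        rw [abs_mul, abs_of_pos hα]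
        gcongr
        have := le_abs_self b
        rw [abs_le]; constructor <;> linarith [hx.1, hx.2]
      · refine Real.rpow_le_rpow_of_bounds (by have := h1.trans_le h1'; positivity)
          (le_trans ?_ (le_max_right _ _)) (le_max_left _ _) h2 (by linarith [hx.2])
        have h3 : 0 ≤ b - 1 := by linarith [hx.1, hx.2]
        gcongr
        exact hx.2
    have hξz : ∀ x ∉ tsupport ξ, ξ x = 0 := fun x => image_eq_zero_of_notMem_tsupport
    have hpow : ∀ᵐ x ∂(volume.restrict Ω), |ξ x| ^ p x ≤ (max 1 M) ^ b := by
      filter_upwards [hab] with x hx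
      exact Real.rpow_le_rpow_of_bounds (abs_nonneg _) ((hM x).trans (le_max_right _ _))
        (le_max_left _ _) (by linarith [hx.1]) hx.2
    have hI₁ : IntegrableOn (fun x => |ξ x| ^ p x * powerWeight₁ α β σ p gradp x) Ω volume := by
      have hu : LocallyIntegrableOn (fun x => 1 + ‖gradp x‖) Ω volume :=
        (locallyIntegrable_const (1 : ℝ)).locallyIntegrableOn Ω |>.add
          hp.weakGradient.locallyIntegrableOn_grad.norm
      -- No lower bound on `σ` is given directly: the hypothesis on `σ` bounds this part of `α K_α`
      -- from below by `(α - 1) C_L`, and `σ ≤ s₀` bounds it from above.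
      set M₀ := |(α - 1) * C_L| + (|α * s₀| + n + α + |b| * |α - 1|)
      refine hu.integrableOn_of_bound (c := (max 1 M) ^ b *
        (Real.exp (Λ * (|α - 1| * |b| + α * (β + 1))) * (M₀ + |α - 1| * (R * Λ)))) hS hsupp ?_ ?_ ?_
      · exact ((hξm.abs.pow hpm).mul hw₁m).aestronglyMeasurable
      · filter_upwards [hab, hmem, hpow, hσp] with x hx hxΩ h1 h2 hxS
        have hΛ0 : 0 ≤ Λ := (norm_nonneg _).trans (hΛ x hxS)
        have hpb : |p x| ≤ |b| := by
          rw [abs_of_pos (by linarith [hx.1])]; exact hx.2.trans (le_abs_self _)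
        have hM₀ : |α * σ x - n + α - p x * (α - 1)| ≤ M₀ := by
          have k1 := neg_abs_le ((α - 1) * C_L)
          have k2 : α * σ x ≤ α * s₀ := by have := hσs x hxΩ; gcongr
          have k3 := le_abs_self (α * s₀)
          have k4 : |p x * (α - 1)| ≤ |b| * |α - 1| := by rw [abs_mul]; gcongr
          have k5 := (abs_le.1 k4).1
          have k6 : (0 : ℝ) ≤ n := n.cast_nonneg
          have k7 := abs_nonneg (α * s₀)
          have k8 := abs_nonneg ((α - 1) * C_L)
          have k9 := (abs_nonneg _).trans k4
          rw [abs_le]; constructor <;> simp only [M₀] <;> linarith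
        have hK : |α * powerK α σ p gradp x| ≤ (M₀ + |α - 1| * (R * Λ)) * (1 + ‖gradp x‖) := by
          have e : α * powerK α σ p gradp x = (α * σ x - n + α - p x * (α - 1)) -
              (α - 1) * (inner ℝ (gradp x) x * Real.log ‖x‖) := by
            unfold powerK gradLogTerm; field_simp; ring
          rw [e]
          have k1 : |(α - 1) * (inner ℝ (gradp x) x * Real.log ‖x‖)| ≤
              |α - 1| * ((‖gradp x‖ * R) * Λ) := by
            rw [abs_mul, abs_mul]
            gcongr
            · refine (abs_real_inner_le_norm _ _).trans ?_
              gcongr; exact hR x hxS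
            · exact hΛ x hxS
          refine (abs_sub _ _).trans ((add_le_add hM₀ k1).trans ?_)
          have k2 : 0 ≤ M₀ := (abs_nonneg _).trans hM₀
          have k3 : 0 ≤ M₀ * ‖gradp x‖ := by positivity
          have k4 : 0 ≤ |α - 1| * (R * Λ) := by positivity
          linarith
        have hE : ‖x‖ ^ (α * (p x - β - 1) - p x) ≤
            Real.exp (Λ * (|α - 1| * |b| + α * (β + 1))) := by
          refine Real.rpow_le_exp_of_abs_log_le (hX x hxΩ) (hΛ x hxS) ?_
          have e : α * (p x - β - 1) - p x = (α - 1) * p x - α * (β + 1) := by ring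
          rw [e]
          refine (abs_sub _ _).trans ?_
          rw [abs_mul, abs_of_pos (by positivity : 0 < α * (β + 1))]
          gcongr
        unfold powerWeight₁
        rw [abs_mul, abs_mul, abs_of_nonneg (by positivity : 0 ≤ |ξ x| ^ p x),
          abs_of_nonneg (by positivity : 0 ≤ ‖x‖ ^ (α * (p x - β - 1) - p x)), mul_assoc, mul_assoc]
        gcongr
      · filter_upwards [hab] with x hx hxS
        rw [hξz x hxS, abs_zero, Real.zero_rpow (by linarith [hx.1]), zero_mul]
    have hI₂ : IntegrableOn (fun x => ‖gradient ξ x‖ ^ p x * powerWeight₂ α β σ p x) Ω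
        volume := by
      refine ((locallyIntegrable_const (1 : ℝ)).locallyIntegrableOn Ω).integrableOn_of_bound
        (c := (max 1 (C : ℝ)) ^ b * W) hS hsupp ?_ ?_ ?_
      · exact ((hdm.pow hpm).mul hw₂m).aestronglyMeasurable
      · filter_upwards [hab, hw₂0, hw₂b] with x hx h1 h2 hxS
        rw [abs_mul, abs_of_nonneg h1, abs_of_nonneg (by positivity), mul_one]
        refine mul_le_mul ?_ (h2 hxS) h1 (by positivity)
        exact Real.rpow_le_rpow_of_bounds (norm_nonneg _) ((hdle x).trans (le_max_right _ _))
          (le_max_left _ _) (by linarith [hx.1]) hx.2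
      · filter_upwards [hab] with x hx hxS
        have : fderiv ℝ ξ x = 0 := by
          by_contra h
          exact hxS (support_fderiv_subset ℝ h)
        rw [hgrad, this, norm_zero, Real.zero_rpow (by linarith [hx.1]), zero_mul]
    have hI₃ : IntegrableOn (fun x => |ξ x * Real.log (|ξ x|)| ^ p x *
        (‖gradp x‖ ^ p x / p x ^ p x) * powerWeight₂ α β σ p x) Ω volume := by
      refine hp.locallyIntegrableOn_grad_rpow.integrableOn_of_bound
        (c := (max 1 M') ^ b * W) hS hsupp ?_ ?_ ?_
      · refine AEMeasurable.aestronglyMeasurable ?_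
        fun_prop
      · filter_upwards [hab, hw₂0, hw₂b] with x hx h1 h2 hxS
        have hp1 : 1 ≤ p x := by linarith [hx.1]
        have hpp : 1 ≤ p x ^ p x := Real.one_le_rpow hp1 (by linarith)
        rw [abs_of_nonneg (by positivity)]
        have k1 : |ξ x * Real.log (|ξ x|)| ^ p x ≤ (max 1 M') ^ b := by
          refine Real.rpow_le_rpow_of_bounds (abs_nonneg _) (le_trans ?_ (le_max_right _ _))
            (le_max_left _ _) (by linarith) hx.2
          rw [Real.log_abs]; exact hM' x hxS
        have k2 : ‖gradp x‖ ^ p x / p x ^ p x ≤ ‖gradp x‖ ^ p x :=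
          div_le_self (by positivity) hpp
        calc _ ≤ (max 1 M') ^ b * ‖gradp x‖ ^ p x * W :=
              mul_le_mul (mul_le_mul k1 k2 (by positivity) (by positivity)) (h2 hxS) h1
                (by positivity)
          _ = _ := by ring
      · filter_upwards [hab] with x hx hxS
        rw [hξz x hxS, zero_mul, abs_zero, Real.zero_rpow (by linarith [hx.1]), zero_mul, zero_mul]
    refine ⟨hI₁, hI₂, hI₃, ?_⟩
    rw [← integral_add hI₂ hI₃]
    -- The divergence, of integral zero, is added on the left before comparing integrands.
    refine le_trans (le_of_eq ?_) (integral_mono_ae (hI₁.add hJi) (hI₂.add hI₃) ?_)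
    · rw [integral_add' hI₁ hJi, hJ0, add_zero]
    · filter_upwards [hab, hmem] with x hx hxΩ
      refine powerWeight_pointwise_le hα ((hσs x hxΩ).trans_lt hs₀) (ha.trans_le hx.1) (hX x hxΩ)
        (norm_nonneg _) (norm_nonneg _) ?_ (abs_real_inner_le_norm _ _)
      rw [hgrad]
      exact (fderiv ℝ ξ x).le_opNorm x
  · have key : ∀ x, (α - 1) * C_L ≤ α * σ x - n + α - p x * (α - 1) →
        (α - 1) * gradLogTerm gradp x ≤ (α - 1) * C_L → 0 ≤ powerK α σ p gradp x := by
      intro x h1 h2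
      have e : powerK α σ p gradp x = (α * σ x - n + α - p x * (α - 1) -
          (α - 1) * gradLogTerm gradp x) / α := by
        unfold powerK; field_simp; ring
      rw [e]
      exact div_nonneg (by linarith) hα.le
    rintro (⟨h1, h2⟩ | ⟨h1, h2⟩)
    · filter_upwards [hσp, h2] with x hx hx2
      exact key x hx (mul_le_mul_of_nonneg_left hx2 (by linarith))
    · filter_upwards [hσp, h2] with x hx hx2
      exact key x hx (mul_le_mul_of_nonpos_left hx2 (by linarith))
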